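/- A framed chord diagram $B$ consists of an oriented circle with finitely many chords whose endpoints are pairwise distinct, together with a framing in $\mathbb{Z}_2$ of each chord; chords of framing $0$ are called untwisted, chords of framing $1$ twisted. It represents a bouquet, i.e. a ribbon graph with one vertex-disc, bounded by the circle, and one ribbon for each chord, attached to the disc at the two ends of the chord; the disc and the ribbon together form an annulus if the chord is untwisted, and a Möbius band if it is twisted. Let $E(B)$ be the set of chords and $F(B)$ the set of boundary components of the ribbon surface. The Euler genus of $B$ is $\varepsilon(B)=2-\chi(B)$, where $\chi(B)=1-|E(B)|+|F(B)|$. For $A\subseteq E(B)$, the partial Petrial $B^{\times|A}$ is obtained from $B$ by adding a half twist to every ribbon in $A$, i.e. by changing the framing of the chords in $A$, and the partial Petrial polynomial of $B$ is $${}^{\partial}\varepsilon^{\times}_{B}(z)=\sum_{A\subseteq E(B)}z^{\varepsilon(B^{\times|A})}.$$ Two distinct chords $a$, $b$ of $B$ are adjacent if an end $x$ of $a$ and an end $y$ of $b$ are consecutive on the circle. Given such ends, let $B'_{a,b}$ be the diagram obtained by exchanging $x$ and $y$ on the circle, and let $\widetilde B_{a,b}$ be the diagram obtained by sliding the end $x$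 of $a$ along $b$: with $y'$ the other end of $b$, the end $x$ is removed and put back immediately next to $y'$, on the other side of $y'$ than the one on which $x$ was of $y$ (with respect to the orientation of the circle) if $b$ is untwisted, and on the same side if $b$ is twisted; moreover the framing of $b$ is added to the framing of $a$. Let $\widetilde{B'}_{a,b}$ be the diagram obtained from $B'_{a,b}$ by sliding the same end $x$ of $a$ along $b$ (in $B'_{a,b}$ the ends $x$ and $y$ are again consecutive). **Theorem.** Let $B$ be a framed chord diagram and let $a$ and $b$ be two adjacent chords of $B$. Then, for any choice of consecutive ends $x$ of $a$ and $y$ of $b$, $${}^{\partial}\varepsilon^{\times}_{B}(z)-{}^{\partial}\varepsilon^{\times}_{\widetilde B_{a,b}}(z)-{}^{\partial}\varepsilon^{\times}_{\widetilde{B'}_{a,b}}(z)+{}^{\partial}\varepsilon^{\times}_{B'_{a,b}}(z)=0.$$ -/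

import Mathlib

open Polynomial

/-- A framed chord diagram whose set of chords is `E`. The two ends of a chord `e` are
`(e, false)` and `(e, true)`; `next` sends each end to the one that follows it on the oriented
circle, and all ends form one cycle of `next` (this is the rotation at the only vertex of the
corresponding bouquet). A chord of framing `0` is untwisted, a chord of framing `1` is twisted. -/
@[ext]
structure ChordDiagram (E : Type*) where
  /-- the successor of an end on the oriented circle -/
  next : Equiv.Perm (E × Bool)
  /-- the ends lie on one circle -/
  isCycleOn : next.IsCycleOn Set.univ
  /-- the framing of the chords -/
  framing : E → ZMod 2

namespace ChordDiagram

variable {E : Type*}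

/-! ### The surface of the bouquet -/

/-- Every end `h` has two corners on the circle: `(h, false)`, where the end starts, and
`(h, true)`, where it stops, in the direction of the circle. The boundary of the ribbon surface
consists of the arcs of the circle between consecutive ends and of the two sides of every ribbon.
`Step` relates the two corners that are the end points of one such arc or side. The ribbon of an
untwisted chord (an annulus, together with the disc) joins the starting corner of each of its ends
to the stopping corner of the other one; a twisted one (a Möbius band) joins starting corner to
starting corner and stopping corner to stopping corner. -/
inductive Step (B : ChordDiagram E) : (E × Bool) × Bool → (E × Bool) × Bool → Prop
  | arc (h : E × Bool) : Step B (h, true) (B.next h, false)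
  | untwisted (e : E) (i s : Bool) : B.framing e = 0 → Step B ((e, i), s) ((e, !i), !s)
  | twisted (e : E) (i s : Bool) : B.framing e = 1 → Step B ((e, i), s) ((e, !i), s)

open Classical in
/-- The number of faces (boundary components of the ribbon surface). If there is no chord, the
surface is a disc, with one boundary component. -/
noncomputable def numFaces (B : ChordDiagram E) : ℕ :=
  if IsEmpty E then 1 else Nat.card (Quot B.Step)

/-- The Euler characteristic `|V| - |E| + |F|` of the bouquet, which has one vertex. -/
noncomputable def eulerChar (B : ChordDiagram E) : ℤ :=
  1 - (Nat.card E : ℤ) + (B.numFaces : ℤ)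

/-- The Euler genus `2 c - χ` of the bouquet, which has `c = 1` connected component. -/
noncomputable def eulerGenus (B : ChordDiagram E) : ℤ :=
  2 * 1 - B.eulerChar

/-- The Euler genus is never negative. -/
theorem eulerGenus_nonneg [Finite E] (B : ChordDiagram E) : 0 ≤ B.eulerGenus := by
  suffices h : B.numFaces ≤ Nat.card E + 1 by
    unfold eulerGenus eulerChar; omega
  unfold numFaces
  split_ifs with hE
  · omega
  rw [not_isEmpty_iff] at hE
  let q : (E × Bool) × Bool → Quot B.Step := Quot.mk _
  let ed : E → Sym2 (Quot B.Step) := fun e => s(q ((e, false), false), q ((e, false), true))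
  let G : SimpleGraph (Quot B.Step) := SimpleGraph.fromEdgeSet (Set.range ed)
  have hf : ∀ e, G.Reachable (q ((e, false), false)) (q ((e, false), true)) := by
    intro e
    by_cases h : q ((e, false), false) = q ((e, false), true)
    · rw [h]
    · apply SimpleGraph.Adj.reachable
      rw [SimpleGraph.fromEdgeSet_adj]
      exact ⟨⟨e, rfl⟩, h⟩
  have hall : ∀ h, G.Reachable (q (h, false)) (q (h, true)) := by
    rintro ⟨e, i⟩
    cases i
    · exact hf e
    · have h01 : B.framing e = 0 ∨ B.framing e = 1 := by
        generalize B.framing e = f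
        revert f
        decide
      rcases h01 with h | h
      · have h1 : q ((e, true), false) = q ((e, false), true) :=
          Quot.sound (Step.untwisted e true false h)
        have h2 : q ((e, true), true) = q ((e, false), false) :=
          Quot.sound (Step.untwisted e true true h)
        rw [h1, h2]
        exact (hf e).symm
      · have h1 : q ((e, true), false) = q ((e, false), false) :=
          Quot.sound (Step.twisted e true false h)
        have h2 : q ((e, true), true) = q ((e, false), true) :=
          Quot.sound (Step.twisted e true true h)
        rw [h1, h2]
        exact hf e
  have hnext : ∀ h, G.Reachable (q (h, false)) (q (B.next h, false)) := by
    intro h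
    have h1 : q (h, true) = q (B.next h, false) := Quot.sound (Step.arc h)
    rw [← h1]
    exact hall h
  have hpow : ∀ (n : ℕ) h, G.Reachable (q (h, false)) (q ((B.next ^ n) h, false)) := by
    intro n
    induction n with
    | zero => intro h; exact SimpleGraph.Reachable.refl _
    | succ k ih =>
      intro h
      rw [pow_succ', Equiv.Perm.mul_apply]
      exact (ih h).trans (hnext _)
  have hff : ∀ h k, G.Reachable (q (h, false)) (q (k, false)) := by
    intro h k
    obtain ⟨n, hn⟩ := (B.isCycleOn.2 (Set.mem_univ h) (Set.mem_univ k)).exists_nat_pow_eq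
    rw [← hn]
    exact hpow n h
  have hto : ∀ c : (E × Bool) × Bool, G.Reachable (q c) (q (c.1, false)) := by
    rintro ⟨h, s⟩
    cases s
    · exact SimpleGraph.Reachable.refl _
    · exact (hall h).symm
  obtain ⟨e₀⟩ := hE
  have : Nonempty (Quot B.Step) := ⟨q ((e₀, false), false)⟩
  have hconn : G.Connected := by
    refine ⟨?_⟩
    intro u v
    induction u using Quot.inductionOn with
    | _ c =>
      induction v using Quot.inductionOn with
      | _ d => exact ((hto c).trans (hff _ _)).trans (hto d).symm
  have h1 := hconn.card_vert_le_card_edgeSet_add_one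
  have h2 : Nat.card G.edgeSet ≤ Nat.card E := by
    have h3 : G.edgeSet ⊆ Set.range ed := by
      rw [SimpleGraph.edgeSet_fromEdgeSet]
      exact Set.sdiff_subset
    calc Nat.card G.edgeSet ≤ Nat.card (Set.range ed) :=
          Nat.card_mono (Set.finite_range ed) h3
      _ ≤ Nat.card E := Finite.card_range_le ed
  omega

/-! ### Partial Petrials -/

/-- The partial Petrial with respect to a set `A` of chords: one more half twist on every ribbon
in `A`. -/
def petrial [DecidableEq E] (B : ChordDiagram E) (A : Finset E) : ChordDiagram E where
  next := B.next
  isCycleOn := B.isCycleOn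
  framing := fun e => if e ∈ A then B.framing e + 1 else B.framing e

/-- The partial Petrial polynomial: the sum of `z ^ ε(B^{×|A})` over all sets `A` of chords.
Euler genera are nonnegative by `eulerGenus_nonneg`, so that `Int.toNat` does not change them. -/
noncomputable def petrialPolynomial [Fintype E] [DecidableEq E] (B : ChordDiagram E) : ℤ[X] :=
  ∑ A : Finset E, X ^ (B.petrial A).eulerGenus.toNat

/-! ### Exchanging and sliding ends -/

/-- The end `x` of a chord and the end `y` of another chord are adjacent on the circle. -/
def AdjacentEnds (B : ChordDiagram E) (x y : E × Bool) : Prop :=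
  x.1 ≠ y.1 ∧ (B.next x = y ∨ B.next y = x)

/-- The other end of the same chord. -/
def otherEnd (y : E × Bool) : E × Bool := (y.1, !y.2)

/-- The circle without `x`: the predecessor of `x` is sent to the successor of `x`, and `x` to
itself. -/
def removeEnd [DecidableEq E] (σ : Equiv.Perm (E × Bool)) (x : E × Bool) :
    Equiv.Perm (E × Bool) :=
  Equiv.swap x (σ x) * σ

/-- Take `x` off the circle and put it back immediately after `t`. -/
def moveAfter [DecidableEq E] (σ : Equiv.Perm (E × Bool)) (x t : E × Bool) :
    Equiv.Perm (E × Bool) :=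
  removeEnd σ x * Equiv.swap x t

/-- Take `x` off the circle and put it back immediately before `t`. -/
def moveBefore [DecidableEq E] (σ : Equiv.Perm (E × Bool)) (x t : E × Bool) :
    Equiv.Perm (E × Bool) :=
  Equiv.swap x t * removeEnd σ x

theorem isCycleOn_moveAfter [Finite E] [DecidableEq E] {σ : Equiv.Perm (E × Bool)}
    (hσ : σ.IsCycleOn Set.univ) {x t : E × Bool} (ht : t ≠ x) :
    (moveAfter σ x t).IsCycleOn Set.univ := by
  set τ := moveAfter σ x t with hτ
  have hrem : ∀ u, removeEnd σ x u = Equiv.swap x (σ x) (σ u) := fun u => rfl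
  have happ : ∀ u, τ u = removeEnd σ x (Equiv.swap x t u) := fun u => rfl
  have hremx : removeEnd σ x x = x := by rw [hrem, Equiv.swap_apply_right]
  have htx : τ t = x := by rw [happ, Equiv.swap_apply_right, hremx]
  have hxt : τ x = removeEnd σ x t := by rw [happ, Equiv.swap_apply_left]
  have hstep : ∀ u, u ≠ x → τ.SameCycle u (removeEnd σ x u) := by
    intro u hu
    by_cases hut : u = t
    · subst hut
      have : τ (τ u) = removeEnd σ x u := by rw [htx, hxt]
      rw [← this]
      exact ((Equiv.Perm.SameCycle.refl τ u).apply_right).apply_right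
    · have : τ u = removeEnd σ x u := by
        rw [happ, Equiv.swap_apply_of_ne_of_ne hu hut]
      rw [← this]
      exact (Equiv.Perm.SameCycle.refl τ u).apply_right
  have hne : ∀ u, u ≠ x → σ u ≠ σ x := fun u hu h => hu (σ.injective h)
  have hpow : ∀ n : ℕ, ((σ ^ n) t ≠ x → τ.SameCycle t ((σ ^ n) t)) ∧
      ((σ ^ n) t = x → σ x ≠ x → τ.SameCycle t (σ x)) := by
    intro n
    induction n with
    | zero => exact ⟨fun _ => Equiv.Perm.SameCycle.refl _ _, fun h => absurd h ht⟩
    | succ k ih =>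
      rw [pow_succ', Equiv.Perm.mul_apply]
      by_cases hk : (σ ^ k) t = x
      · rw [hk]
        exact ⟨fun h => ih.2 hk h, fun h h' => absurd h h'⟩
      · have h1 := (ih.1 hk).trans (hstep _ hk)
        rw [hrem] at h1
        constructor
        · intro h
          rwa [Equiv.swap_apply_of_ne_of_ne h (hne _ hk)] at h1
        · intro h _
          rwa [h, Equiv.swap_apply_left] at h1
  have hall : ∀ u, τ.SameCycle t u := by
    intro u
    by_cases hu : u = x
    · rw [hu, ← htx]
      exact (Equiv.Perm.SameCycle.refl τ t).apply_right
    · obtain ⟨n, hn⟩ := (hσ.2 (Set.mem_univ t) (Set.mem_univ u)).exists_nat_pow_eq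
      rw [← hn] at hu ⊢
      exact (hpow n).1 hu
  exact ⟨Set.bijOn_univ.mpr τ.bijective, fun u _ v _ => (hall u).symm.trans (hall v)⟩

theorem inv_moveAfter_inv [DecidableEq E] (σ : Equiv.Perm (E × Bool)) (x t : E × Bool) :
    (moveAfter σ⁻¹ x t)⁻¹ = moveBefore σ x t := by
  have h : (removeEnd σ⁻¹ x)⁻¹ = removeEnd σ x := by
    unfold removeEnd
    rw [mul_inv_rev, inv_inv, Equiv.swap_inv, Equiv.mul_swap_eq_swap_mul,
      show σ (σ⁻¹ x) = x from σ.apply_symm_apply x, Equiv.swap_comm]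
  unfold moveAfter moveBefore
  rw [mul_inv_rev, Equiv.swap_inv, h]

theorem isCycleOn_moveBefore [Finite E] [DecidableEq E] {σ : Equiv.Perm (E × Bool)}
    (hσ : σ.IsCycleOn Set.univ) {x t : E × Bool} (ht : t ≠ x) :
    (moveBefore σ x t).IsCycleOn Set.univ := by
  rw [← inv_moveAfter_inv, Equiv.Perm.isCycleOn_inv]
  exact isCycleOn_moveAfter (Equiv.Perm.isCycleOn_inv.mpr hσ) ht

theorem AdjacentEnds.otherEnd_ne {B : ChordDiagram E} {x y : E × Bool}
    (h : B.AdjacentEnds x y) : otherEnd y ≠ x :=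
  fun e => h.1 (congrArg Prod.fst e).symm

/-- The diagram `B'`: the adjacent ends `x` and `y` exchange their places on the circle. -/
def exchange [DecidableEq E] (B : ChordDiagram E) (x y : E × Bool) : ChordDiagram E where
  next := Equiv.swap x y * B.next * Equiv.swap x y
  isCycleOn := by
    have h := B.isCycleOn.conj (g := Equiv.swap x y)
    rwa [Equiv.swap_inv, Set.image_univ, Equiv.range_eq_univ] at h
  framing := B.framing

theorem AdjacentEnds.exchange [DecidableEq E] {B : ChordDiagram E} {x y : E × Bool}
    (h : B.AdjacentEnds x y) : (B.exchange x y).AdjacentEnds x y := by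
  refine ⟨h.1, ?_⟩
  simp only [ChordDiagram.exchange, Equiv.Perm.mul_apply, Equiv.swap_apply_left,
    Equiv.swap_apply_right]
  rcases h.2 with h | h
  · right; rw [h, Equiv.swap_apply_right]
  · left; rw [h, Equiv.swap_apply_left]

/-- The diagram obtained by sliding the end `x` of a chord `a` along the chord `b` of the adjacent
end `y`: the end `x` runs along the side of the ribbon `b` that starts at the common corner of `x`
and `y`, and arrives next to the other end `y'` of `b`. If `x` is just before `y`, then it arrives
just after `y'` when `b` is untwisted, and just before `y'` when `b` is twisted; if `x` is just
after `y`, it is the other way round. The half twist of a twisted `b` is added to `a`. -/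
def slide [Finite E] [DecidableEq E] (B : ChordDiagram E) (x y : E × Bool)
    (h : B.AdjacentEnds x y) : ChordDiagram E where
  next :=
    if B.next x = y then
      if B.framing y.1 = 0 then moveAfter B.next x (otherEnd y)
      else moveBefore B.next x (otherEnd y)
    else
      if B.framing y.1 = 0 then moveBefore B.next x (otherEnd y)
      else moveAfter B.next x (otherEnd y)
  isCycleOn := by
    have h1 := isCycleOn_moveAfter B.isCycleOn h.otherEnd_ne
    have h2 := isCycleOn_moveBefore B.isCycleOn h.otherEnd_ne
    split_ifs <;> assumption
  framing := fun e => if e = x.1 then B.framing e + B.framing y.1 else B.framing e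

end ChordDiagram

/-! Partial Petrials of a diagram run through all framings of its circle, so the polynomial is a sum
over all `f : E → ZMod 2` that no longer depends on the framing of the diagram
(`petrialPolynomial_eq_sum_withFraming`). Sliding an end along a ribbon is a handle slide: it keeps
the number of boundary components (`numFaces_slide`), hence the Euler genus.

Where a slide puts `x` depends on two binary data: the order of `x` and `y` on the circle, and the
framing of `b`. Reversing both changes nothing. Write `φ f` for `f` with `f b` added at `a`. If `f`
agrees with `B` at `b`, then the slide of `B`, reframed by `φ f`, is the slide of `B` framed by `f`
(`slide_withFraming_of_eq`); otherwise it is the slide of `B'` framed by `f`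
(`slide_withFraming_of_ne`). The same holds with `B` and `B'` interchanged. As `φ` is an involution,
it reindexes the two slid sums, and for every `f` the four terms cancel in pairs. -/

namespace ChordDiagram

/-! ### Faces under a slide of `x` when `x` is just before `y` -/

section Faces

variable {E : Type*}

/-- The corner maps used for slides collapse some corners, so they are mutually inverse only on the
level of faces. -/
theorem card_quot_eq_of_maps {α β : Type*} {r : α → α → Prop} {s : β → β → Prop}
    (f : α → β) (g : β → α)
    (hf : ∀ a a', r a a' → Quot.mk s (f a) = Quot.mk s (f a'))
    (hg : ∀ b b', s b b' → Quot.mk r (g b) = Quot.mk r (g b'))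
    (hgf : ∀ a, Quot.mk r (g (f a)) = Quot.mk r a)
    (hfg : ∀ b, Quot.mk s (f (g b)) = Quot.mk s b) :
    Nat.card (Quot r) = Nat.card (Quot s) :=
  Nat.card_congr
    { toFun := Quot.lift (fun a => Quot.mk s (f a)) hf
      invFun := Quot.lift (fun b => Quot.mk r (g b)) hg
      left_inv := fun q => Quot.inductionOn q hgf
      right_inv := fun q => Quot.inductionOn q hfg }

theorem framing_eq_zero_or_one (B : ChordDiagram E) (e : E) :
    B.framing e = 0 ∨ B.framing e = 1 := by
  generalize B.framing e = f
  revert f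
  decide

theorem mk_arc (B : ChordDiagram E) {h k : E × Bool} (hk : B.next h = k) :
    Quot.mk B.Step (h, true) = Quot.mk B.Step (k, false) :=
  hk ▸ Quot.sound (Step.arc h)

theorem numFaces_eq_of_card_quot_eq {B C : ChordDiagram E}
    (h : Nat.card (Quot B.Step) = Nat.card (Quot C.Step)) : B.numFaces = C.numFaces := by
  unfold numFaces
  rw [h]

theorem exists_map_of_pair {α : Type*} {y z : α} (v : α) (g : α → α) :
    ∃ f : α → α, f y = v ∧ f z = v ∧ ∀ c, c ≠ y → c ≠ z → f c = g c := by
  classical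
  refine ⟨fun c => if c = y ∨ c = z then v else g c, by simp, by simp, fun c h1 h2 => ?_⟩
  simp [h1, h2]

variable [DecidableEq E]

/-- Write `y'` for the other end of `b`. The slide follows the side of the ribbon `b` from corner
`(y, false)` to `(y', true)`. Before the slide this side lies on the face of `(x, true)`, afterwards
on the face of `(x, false)`. All other corners keep their faces. -/
theorem numFaces_eq_of_next_eq_moveAfter {B C : ChordDiagram E} {a b : E} {i j : Bool}
    (hab : a ≠ b) (hxy : B.next (a, i) = (b, j)) (hb : B.framing b = 0)
    (hC : C.next = moveAfter B.next (a, i) (b, !j)) (hCf : C.framing = B.framing) :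
    B.numFaces = C.numFaces := by
  -- Here `x` lies between `y'` and `y`, so it already is where the slide would put it. The formula
  -- for `C.next (a, i)` below fails in this case.
  by_cases hdeg : B.next (b, !j) = (a, i)
  · have hBC : C = B := by
      refine ChordDiagram.ext ?_ hCf
      rw [hC, moveAfter, removeEnd, mul_assoc, Equiv.mul_swap_eq_swap_mul, ← mul_assoc, hdeg, hxy]
      rw [Equiv.swap_comm (b, j), Equiv.swap_mul_self, one_mul]
    rw [hBC]
  have inj : ∀ u v, B.next u = B.next v → u = v := fun u v h => B.next.injective h
  have hCx : C.next (a, i) = B.next (b, !j) := by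
    rw [hC]
    simp only [moveAfter, removeEnd, Equiv.Perm.mul_apply, Equiv.swap_apply_left, hxy]
    apply Equiv.swap_apply_of_ne_of_ne hdeg
    intro h
    have := inj _ _ (h.trans hxy.symm)
    simp_all
  have hCt : C.next (b, !j) = (a, i) := by
    rw [hC]
    simp only [moveAfter, removeEnd, Equiv.Perm.mul_apply, Equiv.swap_apply_right]
  have hCp : ∀ u, B.next u = (a, i) → C.next u = (b, j) := by
    intro u hu
    have h1 : u ≠ (a, i) := by
      rintro rfl
      simp_all
    have h2 : u ≠ (b, !j) := by
      rintro rfl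
      exact hdeg hu
    rw [hC]
    simp only [moveAfter, removeEnd, Equiv.Perm.mul_apply, Equiv.swap_apply_of_ne_of_ne h1 h2, hu,
      hxy, Equiv.swap_apply_left]
  have hCu : ∀ u, u ≠ (a, i) → u ≠ (b, !j) → B.next u ≠ (a, i) → C.next u = B.next u := by
    intro u h1 h2 h3
    have h4 : B.next u ≠ (b, j) := fun h => h1 (inj _ _ (h.trans hxy.symm))
    rw [hC]
    simp only [moveAfter, removeEnd, Equiv.Perm.mul_apply, Equiv.swap_apply_of_ne_of_ne h1 h2,
      hxy, Equiv.swap_apply_of_ne_of_ne h3 h4]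
  have hsB : Quot.mk B.Step ((b, j), false) = Quot.mk B.Step ((b, !j), true) :=
    Quot.sound (Step.untwisted b j false hb)
  have hsC : Quot.mk C.Step ((b, j), false) = Quot.mk C.Step ((b, !j), true) :=
    Quot.sound (Step.untwisted b j false (hCf ▸ hb))
  -- `f` reads corners of `B` in `C`, and `g` those of `C` in `B`. They differ only in the corner of
  -- `x` to which the two corners of the side are sent.
  obtain ⟨f, fy, ft, fc⟩ := exists_map_of_pair (y := ((b, j), false)) (z := ((b, !j), true))
    ((a, i), true) id
  obtain ⟨g, gy, gt, gc⟩ := exists_map_of_pair (y := ((b, j), false)) (z := ((b, !j), true))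
    ((a, i), false) id
  have fa : ∀ s, f ((a, i), s) = ((a, i), s) := fun s => fc _ (by simp [hab]) (by simp [hab])
  have ga : ∀ s, g ((a, i), s) = ((a, i), s) := fun s => gc _ (by simp [hab]) (by simp [hab])
  have ht : (b, !j) ≠ (a, i) := by simp [hab.symm]
  have hBy : ∀ u, u ≠ (a, i) → B.next u ≠ (b, j) :=
    fun u hu h => hu (inj _ _ (h.trans hxy.symm))
  have hCf' : ∀ {e t}, B.framing e = t → C.framing e = t := fun h => hCf ▸ h
  have fy' : f ((b, j), true) = ((b, j), true) := fc _ (by simp) (by simp)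
  have ft' : f ((b, !j), false) = ((b, !j), false) := fc _ (by simp) (by simp)
  have gy' : g ((b, j), true) = ((b, j), true) := gc _ (by simp) (by simp)
  have gt' : g ((b, !j), false) = ((b, !j), false) := gc _ (by simp) (by simp)
  have fe : ∀ e, e ≠ b → ∀ k s, f ((e, k), s) = ((e, k), s) :=
    fun e he k s => fc _ (by simp [he]) (by simp [he])
  have ge : ∀ e, e ≠ b → ∀ k s, g ((e, k), s) = ((e, k), s) :=
    fun e he k s => gc _ (by simp [he]) (by simp [he])
  have hBxy : Quot.mk B.Step ((a, i), true) = Quot.mk B.Step ((b, j), false) := B.mk_arc hxy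
  have hCtx : Quot.mk C.Step ((b, !j), true) = Quot.mk C.Step ((a, i), false) := C.mk_arc hCt
  apply numFaces_eq_of_card_quot_eq
  refine card_quot_eq_of_maps f g ?_ ?_ ?_ ?_
  · rintro _ _ (h | ⟨e, k, s, he⟩ | ⟨e, k, s, he⟩)
    · by_cases h1 : h = (a, i)
      · rw [h1, hxy, fa, fy]
      by_cases h2 : h = (b, !j)
      · rw [h2, ft, fc _ (by simp [hBy _ ht]) (by simp)]
        exact C.mk_arc hCx
      rw [fc (h, true) (by simp) (by simp [h2])]
      by_cases h3 : B.next h = (a, i)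
      · rw [h3, fa]
        exact (C.mk_arc (hCp h h3)).trans (hsC.trans hCtx)
      · rw [fc _ (by simp [hBy _ h1]) (by simp)]
        exact C.mk_arc (hCu h h1 h2 h3)
    · by_cases h1 : e = b
      · subst h1
        obtain rfl | rfl := Bool.eq_or_eq_not k j <;> cases s
        · rw [Bool.not_false, fy, ft]
        · rw [Bool.not_true, fy', ft']
          exact Quot.sound (Step.untwisted e k true (hCf' he))
        · rw [Bool.not_not, Bool.not_false, fy', ft']
          exact (Quot.sound (Step.untwisted e j true (hCf' he))).symm
        · rw [Bool.not_not, Bool.not_true, fy, ft]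
      · rw [fe e h1, fe e h1]
        exact Quot.sound (Step.untwisted e k s (hCf' he))
    · have h1 : e ≠ b := by
        rintro rfl
        rw [hb] at he
        exact zero_ne_one he
      rw [fe e h1, fe e h1]
      exact Quot.sound (Step.twisted e k s (hCf' he))
  · rintro _ _ (h | ⟨e, k, s, he⟩ | ⟨e, k, s, he⟩)
    · by_cases h1 : h = (a, i)
      · rw [h1, hCx, ga, gc _ (by simp [hBy _ ht]) (by simp)]
        exact hBxy.trans (hsB.trans (B.mk_arc rfl))
      by_cases h2 : h = (b, !j)
      · rw [h2, hCt, gt, ga]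
      rw [gc (h, true) (by simp) (by simp [h2])]
      by_cases h3 : B.next h = (a, i)
      · rw [hCp h h3, gy]
        exact B.mk_arc h3
      · rw [hCu h h1 h2 h3, gc _ (by simp [hBy _ h1]) (by simp)]
        exact B.mk_arc rfl
    · rw [hCf] at he
      by_cases h1 : e = b
      · subst h1
        obtain rfl | rfl := Bool.eq_or_eq_not k j <;> cases s
        · rw [Bool.not_false, gy, gt]
        · rw [Bool.not_true, gy', gt']
          exact Quot.sound (Step.untwisted e k true he)
        · rw [Bool.not_not, Bool.not_false, gy', gt']
          exact (Quot.sound (Step.untwisted e j true he)).symm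
        · rw [Bool.not_not, Bool.not_true, gy, gt]
      · rw [ge e h1, ge e h1]
        exact Quot.sound (Step.untwisted e k s he)
    · rw [hCf] at he
      have h1 : e ≠ b := by
        rintro rfl
        rw [hb] at he
        exact zero_ne_one he
      rw [ge e h1, ge e h1]
      exact Quot.sound (Step.twisted e k s he)
  · intro c
    by_cases h1 : c = ((b, j), false)
    · rw [h1, fy, ga, hBxy]
    by_cases h2 : c = ((b, !j), true)
    · rw [h2, ft, ga, hBxy, hsB]
    rw [fc c h1 h2, id, gc c h1 h2, id]
  · intro c
    by_cases h1 : c = ((b, j), false)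
    · rw [h1, gy, fa, hsC, hCtx]
    by_cases h2 : c = ((b, !j), true)
    · rw [h2, gt, fa, hCtx]
    rw [gc c h1 h2, id, fc c h1 h2, id]

/-- Passing along a twisted ribbon turns `x` over, so its two corners exchange their faces; the
change of framing of `a` compensates for this on the sides of the ribbon `a`. No degenerate case
arises, since `x` is followed by `y` and so cannot already be just before `y'`. -/
theorem numFaces_eq_of_next_eq_moveBefore {B C : ChordDiagram E} {a b : E} {i j : Bool}
    (hab : a ≠ b) (hxy : B.next (a, i) = (b, j)) (hb : B.framing b = 1)
    (hC : C.next = moveBefore B.next (a, i) (b, !j))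
    (hCf : C.framing = fun e => if e = a then B.framing e + 1 else B.framing e) :
    B.numFaces = C.numFaces := by
  have inj : ∀ u v, B.next u = B.next v → u = v := fun u v h => B.next.injective h
  have hC' : ∀ u, C.next u = Equiv.swap (a, i) (b, !j) (Equiv.swap (a, i) (b, j) (B.next u)) := by
    intro u
    rw [hC, moveBefore, removeEnd, hxy]
    rfl
  have hCx : C.next (a, i) = (b, !j) := by
    rw [hC', hxy, Equiv.swap_apply_right, Equiv.swap_apply_left]
  have hCp : ∀ u, B.next u = (a, i) → C.next u = (b, j) := by
    intro u hu
    rw [hC', hu, Equiv.swap_apply_left, Equiv.swap_apply_of_ne_of_ne] <;> simp [hab.symm]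
  have hCr : ∀ u, B.next u = (b, !j) → C.next u = (a, i) := by
    intro u hu
    have h : Equiv.swap (a, i) (b, j) (b, !j) = (b, !j) :=
      Equiv.swap_apply_of_ne_of_ne (by simp [hab.symm]) (by simp)
    rw [hC', hu, h, Equiv.swap_apply_right]
  have hCu : ∀ u, u ≠ (a, i) → B.next u ≠ (a, i) → B.next u ≠ (b, !j) →
      C.next u = B.next u := by
    intro u h1 h2 h3
    have h4 : B.next u ≠ (b, j) := fun h => h1 (inj _ _ (h.trans hxy.symm))
    rw [hC', Equiv.swap_apply_of_ne_of_ne h2 h4, Equiv.swap_apply_of_ne_of_ne h2 h3]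
  have hBC : C.framing a = B.framing a + 1 := by simp [hCf]
  have hCe : ∀ e, e ≠ a → C.framing e = B.framing e := fun e he => by simp [hCf, he]
  have hsB : Quot.mk B.Step ((b, j), false) = Quot.mk B.Step ((b, !j), false) :=
    Quot.sound (Step.twisted b j false hb)
  have hsC : Quot.mk C.Step ((b, j), false) = Quot.mk C.Step ((b, !j), false) :=
    Quot.sound (Step.twisted b j false ((hCe b hab.symm).trans hb))
  -- The side along which `x` slides lies on the face of `(x, true)` both in `B` and in `C`. Since
  -- the corners of `x` are exchanged, it must go to `(x, false)`, and the same map serves in both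
  -- directions.
  obtain ⟨f, fy, ft, fc⟩ := exists_map_of_pair (y := ((b, j), false)) (z := ((b, !j), false))
    ((a, i), false) (fun c => if c.1 = (a, i) then (c.1, !c.2) else c)
  have fa : ∀ s, f ((a, i), s) = ((a, i), !s) :=
    fun s => (fc _ (by simp [hab]) (by simp [hab])).trans (by simp)
  have fd : ∀ c, c ≠ ((b, j), false) → c ≠ ((b, !j), false) → c.1 ≠ (a, i) → f c = c :=
    fun c h1 h2 h3 => (fc c h1 h2).trans (if_neg h3)
  have fy' : f ((b, j), true) = ((b, j), true) := fd _ (by simp) (by simp) (by simp [hab.symm])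
  have ft' : f ((b, !j), true) = ((b, !j), true) :=
    fd _ (by simp) (by simp) (by simp [hab.symm])
  have fe : ∀ e, e ≠ b → ∀ {k}, (e, k) ≠ (a, i) → ∀ s, f ((e, k), s) = ((e, k), s) :=
    fun e he k hk s => fd _ (by simp [he]) (by simp [he]) hk
  have hBy : ∀ u, u ≠ (a, i) → B.next u ≠ (b, j) :=
    fun u hu h => hu (inj _ _ (h.trans hxy.symm))
  have hbC : C.framing b = 1 := (hCe b hab.symm).trans hb
  have hCB : B.framing a = C.framing a + 1 := by
    rw [hBC, add_assoc, show (1 + 1 : ZMod 2) = 0 from rfl, add_zero]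
  have hBxy : Quot.mk B.Step ((a, i), true) = Quot.mk B.Step ((b, j), false) := B.mk_arc hxy
  have hCxt : Quot.mk C.Step ((a, i), true) = Quot.mk C.Step ((b, !j), false) := C.mk_arc hCx
  apply numFaces_eq_of_card_quot_eq
  refine card_quot_eq_of_maps f f ?_ ?_ ?_ ?_
  · rintro _ _ (h | ⟨e, k, s, he⟩ | ⟨e, k, s, he⟩)
    · by_cases h1 : h = (a, i)
      · rw [h1, hxy, fa, fy, Bool.not_true]
      rw [fd (h, true) (by simp) (by simp) h1]
      by_cases h2 : B.next h = (a, i)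
      · rw [h2, fa, Bool.not_false]
        exact (C.mk_arc (hCp h h2)).trans (hsC.trans hCxt.symm)
      by_cases h3 : B.next h = (b, !j)
      · rw [h3, ft]
        exact C.mk_arc (hCr h h3)
      · rw [fd _ (by simp [hBy _ h1]) (by simp [h3]) h2]
        exact C.mk_arc (hCu h h1 h2 h3)
    · have h1 : e ≠ b := by
        rintro rfl
        rw [hb] at he
        exact one_ne_zero he
      by_cases h2 : e = a
      · subst h2
        have h3 : C.framing e = 1 := by rw [hBC, he, zero_add]
        obtain rfl | rfl := Bool.eq_or_eq_not k i
        · rw [fa, fe e h1 (by simp)]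
          exact Quot.sound (Step.twisted e k (!s) h3)
        · rw [Bool.not_not, fa, fe e h1 (by simp), Bool.not_not]
          exact (Quot.sound (Step.twisted e i s h3)).symm
      · rw [fe e h1 (by simp [h2]), fe e h1 (by simp [h2])]
        exact Quot.sound (Step.untwisted e k s (by rw [← he, hCe e h2]))
    · by_cases h1 : e = b
      · subst h1
        obtain rfl | rfl := Bool.eq_or_eq_not k j <;> cases s
        · rw [fy, ft]
        · rw [fy', ft']
          exact Quot.sound (Step.twisted e k true hbC)
        · rw [Bool.not_not, fy, ft]
        · rw [Bool.not_not, fy', ft']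
          exact (Quot.sound (Step.twisted e j true hbC)).symm
      by_cases h2 : e = a
      · subst h2
        have h3 : C.framing e = 0 := by rw [hBC, he]; rfl
        obtain rfl | rfl := Bool.eq_or_eq_not k i
        · rw [fa, fe e h1 (by simp)]
          simpa using Quot.sound (Step.untwisted e k (!s) h3)
        · rw [Bool.not_not, fa, fe e h1 (by simp)]
          simpa using (Quot.sound (Step.untwisted e i (!s) h3)).symm
      · rw [fe e h1 (by simp [h2]), fe e h1 (by simp [h2])]
        exact Quot.sound (Step.twisted e k s (by rw [← he, hCe e h2]))
  · rintro _ _ (h | ⟨e, k, s, he⟩ | ⟨e, k, s, he⟩)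
    · by_cases h1 : h = (a, i)
      · rw [h1, hCx, fa, ft, Bool.not_true]
      rw [fd (h, true) (by simp) (by simp) h1]
      by_cases h2 : B.next h = (a, i)
      · rw [hCp h h2, fy]
        exact B.mk_arc h2
      by_cases h3 : B.next h = (b, !j)
      · rw [hCr h h3, fa, Bool.not_false, hBxy, hsB, ← h3]
        exact B.mk_arc rfl
      · rw [hCu h h1 h2 h3, fd _ (by simp [hBy _ h1]) (by simp [h3]) h2]
        exact B.mk_arc rfl
    · have h1 : e ≠ b := by
        rintro rfl
        rw [hbC] at he
        exact one_ne_zero he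
      by_cases h2 : e = a
      · subst h2
        have h3 : B.framing e = 1 := by rw [hCB, he, zero_add]
        obtain rfl | rfl := Bool.eq_or_eq_not k i
        · rw [fa, fe e h1 (by simp)]
          exact Quot.sound (Step.twisted e k (!s) h3)
        · rw [Bool.not_not, fa, fe e h1 (by simp), Bool.not_not]
          exact (Quot.sound (Step.twisted e i s h3)).symm
      · rw [fe e h1 (by simp [h2]), fe e h1 (by simp [h2])]
        exact Quot.sound (Step.untwisted e k s (by rw [← he, hCe e h2]))
    · by_cases h1 : e = b
      · subst h1
        obtain rfl | rfl := Bool.eq_or_eq_not k j <;> cases s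
        · rw [fy, ft]
        · rw [fy', ft']
          exact Quot.sound (Step.twisted e k true hb)
        · rw [Bool.not_not, fy, ft]
        · rw [Bool.not_not, fy', ft']
          exact (Quot.sound (Step.twisted e j true hb)).symm
      by_cases h2 : e = a
      · subst h2
        have h3 : B.framing e = 0 := by rw [hCB, he]; rfl
        obtain rfl | rfl := Bool.eq_or_eq_not k i
        · rw [fa, fe e h1 (by simp)]
          simpa using Quot.sound (Step.untwisted e k (!s) h3)
        · rw [Bool.not_not, fa, fe e h1 (by simp)]
          simpa using (Quot.sound (Step.untwisted e i (!s) h3)).symm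
      · rw [fe e h1 (by simp [h2]), fe e h1 (by simp [h2])]
        exact Quot.sound (Step.twisted e k s (by rw [← he, hCe e h2]))
  · intro c
    by_cases h1 : c = ((b, j), false)
    · rw [h1, fy, fa, Bool.not_false, hBxy]
    by_cases h2 : c = ((b, !j), false)
    · rw [h2, ft, fa, Bool.not_false, hBxy, hsB]
    by_cases h3 : c.1 = (a, i)
    · obtain ⟨u, s⟩ := c
      obtain rfl : u = (a, i) := h3
      rw [fa, fa, Bool.not_not]
    · rw [fd c h1 h2 h3, fd c h1 h2 h3]
  · intro c
    by_cases h1 : c = ((b, j), false)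
    · rw [h1, fy, fa, Bool.not_false, hCxt, hsC]
    by_cases h2 : c = ((b, !j), false)
    · rw [h2, ft, fa, Bool.not_false, hCxt]
    by_cases h3 : c.1 = (a, i)
    · obtain ⟨u, s⟩ := c
      obtain rfl : u = (a, i) := h3
      rw [fa, fa, Bool.not_not]
    · rw [fd c h1 h2 h3, fd c h1 h2 h3]

end Faces

end ChordDiagram

namespace ChordDiagram

/-! ### Reversal of the circle and invariance of the Euler genus under slides -/

section Slide

variable {E : Type*}

/-- The diagram read along the circle with the opposite orientation. -/
def mirror (B : ChordDiagram E) : ChordDiagram E where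
  next := B.next⁻¹
  isCycleOn := Equiv.Perm.isCycleOn_inv.mpr B.isCycleOn
  framing := B.framing

/-- Reversing the circle interchanges starting and stopping corners. This reduces slides with `x`
just after `y` to those with `x` just before `y`. -/
theorem numFaces_mirror (B : ChordDiagram E) : B.mirror.numFaces = B.numFaces := by
  apply numFaces_eq_of_card_quot_eq
  refine card_quot_eq_of_maps (fun c => (c.1, !c.2)) (fun c => (c.1, !c.2)) ?_ ?_ ?_ ?_
  · rintro _ _ (h | ⟨e, k, s, he⟩ | ⟨e, k, s, he⟩)
    · exact (B.mk_arc (B.next.apply_symm_apply h)).symm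
    · exact Quot.sound (Step.untwisted e k (!s) he)
    · exact Quot.sound (Step.twisted e k (!s) he)
  · rintro _ _ (h | ⟨e, k, s, he⟩ | ⟨e, k, s, he⟩)
    · exact (B.mirror.mk_arc (B.next.symm_apply_apply h)).symm
    · exact Quot.sound (Step.untwisted (B := B.mirror) e k (!s) he)
    · exact Quot.sound (Step.twisted (B := B.mirror) e k (!s) he)
  · simp
  · simp

variable [Finite E] [DecidableEq E]

theorem numFaces_slide (B : ChordDiagram E) (x y : E × Bool) (h : B.AdjacentEnds x y) :
    (B.slide x y h).numFaces = B.numFaces := by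
  obtain ⟨a, i⟩ := x
  obtain ⟨b, j⟩ := y
  have hab : a ≠ b := h.1
  have hf0 : B.framing b = 0 → (B.slide (a, i) (b, j) h).framing = B.framing := by
    intro hb
    funext e
    simp [slide, hb]
  have hf1 : B.framing b = 1 → (B.slide (a, i) (b, j) h).framing =
      fun e => if e = a then B.framing e + 1 else B.framing e := by
    intro hb
    funext e
    simp [slide, hb]
  by_cases hxy : B.next (a, i) = (b, j)
  · rcases B.framing_eq_zero_or_one b with hb | hb
    · refine (numFaces_eq_of_next_eq_moveAfter hab hxy hb ?_ (hf0 hb)).symm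
      simp [slide, hxy, hb, otherEnd]
    · refine (numFaces_eq_of_next_eq_moveBefore hab hxy hb ?_ (hf1 hb)).symm
      simp [slide, hxy, hb, otherEnd]
  · have hyx : B.mirror.next (a, i) = (b, j) :=
      Equiv.Perm.inv_eq_iff_eq.mpr (h.2.resolve_left hxy).symm
    rw [← numFaces_mirror, ← numFaces_mirror B]
    rcases B.framing_eq_zero_or_one b with hb | hb
    · refine (numFaces_eq_of_next_eq_moveAfter
        (C := (B.slide (a, i) (b, j) h).mirror) hab hyx hb ?_ (hf0 hb)).symm
      -- Putting `x` before `y'` is putting it after `y'` on the reversed circle.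
      rw [eq_comm, ← inv_inj, mirror, inv_moveAfter_inv]
      simp [mirror, slide, hxy, hb, otherEnd]
    · refine (numFaces_eq_of_next_eq_moveBefore
        (C := (B.slide (a, i) (b, j) h).mirror) hab hyx hb ?_ (hf1 hb)).symm
      rw [← inv_moveAfter_inv]
      simp [mirror, slide, hxy, hb, otherEnd]

theorem eulerGenus_slide (B : ChordDiagram E) (x y : E × Bool) (h : B.AdjacentEnds x y) :
    (B.slide x y h).eulerGenus = B.eulerGenus := by
  unfold eulerGenus eulerChar
  rw [numFaces_slide]

end Slide

/-! ### Slides and changes of framing -/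

section Framing

variable {E : Type*}

/-- The diagram with the same circle and with the framing replaced by `f`. -/
def withFraming (B : ChordDiagram E) (f : E → ZMod 2) : ChordDiagram E where
  next := B.next
  isCycleOn := B.isCycleOn
  framing := f

theorem AdjacentEnds.withFraming {B : ChordDiagram E} {x y : E × Bool} (h : B.AdjacentEnds x y)
    (f : E → ZMod 2) : (B.withFraming f).AdjacentEnds x y :=
  h

/-- Otherwise `{x, y}` would be a whole cycle of `next`, which leaves out the other end of `b`. So
the two orders of `x` and `y` exclude each other, and the exchange really reverses the order. -/
theorem AdjacentEnds.next_ne_of_next_eq {B : ChordDiagram E} {x y : E × Bool}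
    (h : B.AdjacentEnds x y) (hxy : B.next x = y) : B.next y ≠ x := by
  intro hyx
  obtain ⟨n, hn⟩ := B.isCycleOn.2 (Set.mem_univ x) (Set.mem_univ (otherEnd y))
  have hmem : ∀ u, u ∈ ({x, y} : Set (E × Bool)) ↔ B.next u ∈ ({x, y} : Set (E × Bool)) := by
    intro u
    simp only [Set.mem_insert_iff, Set.mem_singleton_iff]
    constructor
    · rintro (rfl | rfl)
      · exact Or.inr hxy
      · exact Or.inl hyx
    · rintro (hu | hu)
      · exact Or.inr (B.next.injective (hu.trans hyx.symm))
      · exact Or.inl (B.next.injective (hu.trans hxy.symm))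
  have hpow : ∀ n : ℤ, (B.next ^ n) x ∈ ({x, y} : Set (E × Bool)) := by
    intro n
    induction n with
    | zero => simp
    | succ k ih => rwa [add_comm, zpow_add, zpow_one, Equiv.Perm.mul_apply, ← hmem]
    | pred k ih =>
      rw [hmem, ← Equiv.Perm.mul_apply, ← zpow_one_add]
      convert ih using 3
      ring
  rcases hn ▸ hpow n with h1 | h1
  · exact h.otherEnd_ne h1
  · have := congrArg Prod.snd h1
    simp [otherEnd] at this

variable [DecidableEq E]

/-- Adding the indicator function of `A` to a fixed framing is a bijection from sets of chords to
framings. -/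
theorem petrialPolynomial_eq_sum_withFraming [Fintype E] (B : ChordDiagram E) :
    B.petrialPolynomial = ∑ f : E → ZMod 2, X ^ (B.withFraming f).eulerGenus.toNat := by
  refine Fintype.sum_bijective
    (fun (A : Finset E) e => if e ∈ A then B.framing e + 1 else B.framing e) ⟨?_, ?_⟩ _ _
    fun A => rfl
  · intro A A' h
    ext e
    have h' := congrFun h e
    by_cases h1 : e ∈ A <;> by_cases h2 : e ∈ A' <;> simp_all
  · intro f
    refine ⟨Finset.univ.filter fun e => f e ≠ B.framing e, funext fun e => ?_⟩
    simp only [Finset.mem_filter, Finset.mem_univ, true_and]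
    generalize f e = u, B.framing e = v
    revert u v
    decide

/-- The effect on framings of sliding an end of `a` along `b`. -/
def slideFraming (a b : E) (f : E → ZMod 2) (e : E) : ZMod 2 :=
  if e = a then f e + f b else f e

theorem slideFraming_involutive {a b : E} (hab : a ≠ b) :
    Function.Involutive (slideFraming a b) := by
  intro f
  funext e
  by_cases he : e = a
  · simp [slideFraming, he, hab.symm, add_assoc, CharTwo.add_self_eq_zero]
  · simp [slideFraming, he]

/-- The framing influences the new place of `x` only through its value at `b`. -/
theorem slide_withFraming_of_eq [Finite E] {B : ChordDiagram E} {x y : E × Bool}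
    (h : B.AdjacentEnds x y) {f : E → ZMod 2} (hf : f y.1 = B.framing y.1) :
    (B.withFraming f).slide x y (h.withFraming f) =
      (B.slide x y h).withFraming (slideFraming x.1 y.1 f) := by
  refine ChordDiagram.ext ?_ rfl
  simp only [slide, withFraming, hf]

/-- Since `x` is taken off first, the old circle matters only through what remains without `x` and
through the order of `x` and `y`. Passing to `C` reverses this order, which makes up for the
opposite framing of `b`. The case of interest is `C = B'`, or the same with `B` and `B'`
interchanged. -/
theorem slide_withFraming_of_ne [Finite E] {B C : ChordDiagram E} {x y : E × Bool}
    (hB : B.AdjacentEnds x y) (hC : C.AdjacentEnds x y)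
    (hrem : removeEnd C.next x = removeEnd B.next x) (hxy : C.next x = y ↔ B.next x ≠ y)
    (hfr : C.framing y.1 = B.framing y.1) {f : E → ZMod 2} (hf : f y.1 ≠ B.framing y.1) :
    (B.withFraming f).slide x y (hB.withFraming f) =
      (C.slide x y hC).withFraming (slideFraming x.1 y.1 f) := by
  refine ChordDiagram.ext ?_ rfl
  have hf' : f y.1 = 0 ↔ ¬ B.framing y.1 = 0 := by
    revert hf
    generalize f y.1 = u, B.framing y.1 = v
    revert u v
    decide
  by_cases h1 : B.next x = y <;> by_cases h2 : B.framing y.1 = 0 <;>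
    simp [slide, withFraming, hf', h1, h2, hfr, hxy, moveAfter, moveBefore, hrem]

/-- Exchanging neighbours `x` and `y` amounts to moving `x` past `y`, which is not seen once `x` is
removed. -/
theorem AdjacentEnds.removeEnd_exchange {B : ChordDiagram E} {x y : E × Bool}
    (h : B.AdjacentEnds x y) :
    removeEnd (B.exchange x y).next x = removeEnd B.next x := by
  simp only [removeEnd, ChordDiagram.exchange, Equiv.Perm.mul_apply, Equiv.swap_apply_left]
  rcases h.2 with hxy | hyx
  · have h1 := Equiv.mul_swap_eq_swap_mul (Equiv.swap x y) y (B.next y)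
    have h2 := Equiv.mul_swap_eq_swap_mul B.next x y
    rw [Equiv.swap_apply_right] at h1
    rw [hxy] at h2 ⊢
    rw [← mul_assoc, ← mul_assoc, ← h1, mul_assoc (Equiv.swap x y), ← h2, mul_assoc, mul_assoc,
      Equiv.swap_mul_self, mul_one]
  · rw [hyx, Equiv.swap_apply_left, ← mul_assoc, ← mul_assoc, Equiv.swap_mul_self, one_mul,
      Equiv.mul_swap_eq_swap_mul, hyx, Equiv.swap_comm]

theorem AdjacentEnds.next_exchange_eq_iff {B : ChordDiagram E} {x y : E × Bool}
    (h : B.AdjacentEnds x y) : (B.exchange x y).next x = y ↔ B.next x ≠ y := by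
  have h1 : (B.exchange x y).next x = y ↔ B.next y = x := by
    simp only [ChordDiagram.exchange, Equiv.Perm.mul_apply, Equiv.swap_apply_left]
    rw [← Equiv.eq_symm_apply, Equiv.symm_swap, Equiv.swap_apply_right]
  rw [h1]
  exact ⟨fun hyx hxy => h.next_ne_of_next_eq hxy hyx, h.2.resolve_left⟩

theorem eulerGenus_withFraming_slide [Finite E] {B : ChordDiagram E} {x y : E × Bool}
    (h : B.AdjacentEnds x y) (f : E → ZMod 2) :
    (f y.1 = B.framing y.1 →
      ((B.slide x y h).withFraming (slideFraming x.1 y.1 f)).eulerGenus =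
          (B.withFraming f).eulerGenus ∧
        (((B.exchange x y).slide x y h.exchange).withFraming
            (slideFraming x.1 y.1 f)).eulerGenus =
          ((B.exchange x y).withFraming f).eulerGenus) ∧
    (f y.1 ≠ B.framing y.1 →
      ((B.slide x y h).withFraming (slideFraming x.1 y.1 f)).eulerGenus =
          ((B.exchange x y).withFraming f).eulerGenus ∧
        (((B.exchange x y).slide x y h.exchange).withFraming
            (slideFraming x.1 y.1 f)).eulerGenus =
          (B.withFraming f).eulerGenus) := by
  refine ⟨fun hf => ⟨?_, ?_⟩, fun hf => ⟨?_, ?_⟩⟩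
  · rw [← slide_withFraming_of_eq h hf, eulerGenus_slide]
  · rw [← slide_withFraming_of_eq h.exchange hf, eulerGenus_slide]
  · rw [← slide_withFraming_of_ne h.exchange h h.removeEnd_exchange.symm
      (by rw [ne_eq, h.next_exchange_eq_iff, not_not]) rfl hf, eulerGenus_slide]
  · rw [← slide_withFraming_of_ne h h.exchange h.removeEnd_exchange h.next_exchange_eq_iff rfl hf,
      eulerGenus_slide]

end Framing

end ChordDiagram

/-! ### Cancellation framing by framing -/

theorem theorem3 {E : Type*} [Fintype E] [DecidableEq E] (B : ChordDiagram E) (a b : E)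
    (i j : Bool) (h : B.AdjacentEnds (a, i) (b, j)) :
    B.petrialPolynomial
      - (B.slide (a, i) (b, j) h).petrialPolynomial
      - ((B.exchange (a, i) (b, j)).slide (a, i) (b, j) h.exchange).petrialPolynomial
      + (B.exchange (a, i) (b, j)).petrialPolynomial = 0 := by
  open ChordDiagram in
  have hinv := slideFraming_involutive (a := a) (b := b) h.1
  have hsum : ∀ C : ChordDiagram E, C.petrialPolynomial =
      ∑ f, X ^ (C.withFraming (slideFraming a b f)).eulerGenus.toNat := fun C =>
    C.petrialPolynomial_eq_sum_withFraming.trans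
      (Fintype.sum_bijective _ hinv.bijective _ _ fun f => rfl).symm
  -- Only the sums of the two slid diagrams are reindexed by `slideFraming`, so that the terms at
  -- the same `f` correspond.
  rw [hsum (B.slide _ _ h), hsum ((B.exchange _ _).slide _ _ h.exchange),
    B.petrialPolynomial_eq_sum_withFraming,
    (B.exchange (a, i) (b, j)).petrialPolynomial_eq_sum_withFraming,
    ← Finset.sum_sub_distrib, ← Finset.sum_sub_distrib, ← Finset.sum_add_distrib]
  refine Finset.sum_eq_zero fun f _ => ?_
  obtain ⟨heq, hne⟩ := eulerGenus_withFraming_slide h f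
  -- If `f` agrees with `B` at `b`, the slid diagrams cancel against their own originals; otherwise
  -- each cancels against the original of the other.
  by_cases hf : f b = B.framing b
  · rw [(heq hf).1, (heq hf).2]
    ring
  · rw [(hne hf).1, (hne hf).2]
    ring
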